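/- Let $w=w[1]\cdots w[n]$ be a word of length $n$ over an arbitrary alphabet. A factor of $w$ is a nonempty fragment $r=w[i..j]$, $1\le i\le j\le n$; factors at different positions are regarded as different. A period of a word $v$ is a positive integer $p$ with $v[k]=v[k+p]$ for all $1\le k\le |v|-p$; let $p(v)$ be the minimal period of $v$ and $e(v)=|v|/p(v)$ its exponent. For $0<\delta<1$, a $\delta$-subrepetition in $w$ is a factor $r$ of $w$ with $1+\delta\le e(r)<2$. A $\delta$-subrepetition $r=w[i..j]$ is called maximal if (1) $i>1$ implies $w[i-1]\ne w[i-1+p(r)]$, and (2) $j<n$ implies $w[j+1-p(r)]\ne w[j+1]$. Then the number of maximal $\delta$-subrepetitions in $w$ is $O(n/\delta^2)$: there is an absolute constant $C>0$, independent of the alphabet, of $w$, of $n$ and of $\delta$, such that for every word $w$ of length $n$ and every real $\delta$ with $0<\delta<1$ the number of maximal $\delta$-subrepetitions in $w$ is at most $C\,n/\delta^2$. -/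

import Mathlib

namespace Subrep

/-- The minimal period of a word: its least positive period. -/
noncomputable def minPeriod {A : Type*} (v : List A) : ℕ :=
  sInf {p : ℕ | 0 < p ∧ v.HasPeriod p}

/-- The exponent of a word: its length divided by its minimal period. -/
noncomputable def exponent {A : Type*} (v : List A) : ℝ :=
  (v.length : ℝ) / (minPeriod v : ℝ)

/-- The word `w[i] w[i+1] ⋯ w[j-1]` (positions counted from `0`). -/
def factor {A : Type*} (w : List A) (i j : ℕ) : List A :=
  (w.drop i).take (j - i)

/-- The pair `(i, j)` is the fragment of `w` covering the positions `i, …, j - 1`; fragments are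
nonempty and lie inside `w`. -/
def IsFragment {A : Type*} (w : List A) (r : ℕ × ℕ) : Prop :=
  r.1 < r.2 ∧ r.2 ≤ w.length

/-- The fragment `r` is a `δ`-subrepetition of `w`: its exponent lies in `[1 + δ, 2)`. -/
def IsSubrepetition {A : Type*} (δ : ℝ) (w : List A) (r : ℕ × ℕ) : Prop :=
  IsFragment w r ∧ 1 + δ ≤ exponent (factor w r.1 r.2) ∧ exponent (factor w r.1 r.2) < 2

/-- The fragment `r` of `w` cannot be extended by one letter to the left or to the right with
preservation of its minimal period. As `1 ≤ minPeriod ≤ r.2 - r.1` for a fragment `r`, all the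
positions compared below lie inside `w` and no subtraction truncates. -/
def IsMaximal {A : Type*} (w : List A) (r : ℕ × ℕ) : Prop :=
  (0 < r.1 → w[r.1 - 1]? ≠ w[r.1 - 1 + minPeriod (factor w r.1 r.2)]?) ∧
  (r.2 < w.length → w[r.2 - minPeriod (factor w r.1 r.2)]? ≠ w[r.2]?)

/-- The set of all maximal `δ`-subrepetitions of `w`. Two of them with distinct positions are
distinct, even if they are equal as words. -/
def maxSubrepetitions {A : Type*} (δ : ℝ) (w : List A) : Set (ℕ × ℕ) :=
  {r | IsSubrepetition δ w r ∧ IsMaximal w r}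

end Subrep

/-! A maximal subrepetition is a maximal repeat: two equal arms of length `s ≥ δp` at distance `p`.
Let `g = ⌊δp/10⌋`; repeats are split by whether the middle of the left arm has a period at most `g`.

If not, the repeat charges the points `(x, y)` of `[i, i+g] × [p, p+g]`. A point charged twice would
give that short period (`exists_short_period`), so the boxes are disjoint. With weight `1/y²` each
box weighs at least `δ²/400` and all points together at most `2n`, leaving at most `800n/δ²` such
repeats.

If so, with least period `q`, maximality on the left forces the `q`-period to break near the left
end of some arm (`IsMaxRepeat.exists_isAnchored`). Such a repeat is recovered from a position, which
encodes `q`, the periodic stretch and the quotient of `⌊p/q⌋` by `M = ⌈4/δ⌉`, and a residue modulo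
`M` (`IsAnchored.unique`, `Unbordered.shift_unique`). This leaves at most `nM ≤ 5n/δ²` for each arm.
-/

namespace Subrep

variable {B : Type*}

/-! ### Maximal repeats and unbordered words -/

/-- The restriction of `f` to the interval `[u, v)` has the period `d`. -/
def PeriodOn (f : ℤ → B) (d u v : ℤ) : Prop :=
  ∀ x, u ≤ x → x + d < v → f x = f (x + d)

/-- The word `f` on `[h, h + q)` has no period shorter than its length. -/
def Unbordered (f : ℤ → B) (h q : ℤ) : Prop :=
  ∀ d, 0 < d → d < q → ¬ PeriodOn f d h (h + q)

/-- The arms `[i, i + s)` and `[i + p, i + p + s)` carry equal words, and this fails for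
both one-letter extensions. -/
structure IsMaxRepeat (f : ℤ → B) (i p s : ℤ) : Prop where
  period_pos : 0 < p
  arm_pos : 0 < s
  eq_shift : ∀ x, i ≤ x → x < i + s → f x = f (x + p)
  left_ne : f (i - 1) ≠ f (i - 1 + p)
  right_ne : f (i + s) ≠ f (i + s + p)

theorem PeriodOn.mono {f : ℤ → B} {d u v u' v' : ℤ} (h : PeriodOn f d u v) (hu : u ≤ u')
    (hv : v' ≤ v) : PeriodOn f d u' v' :=
  fun x hx hx' => h x (by lia) (by lia)

/-- A maximal repeat is determined by its period and one position of its left arm. -/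
theorem IsMaxRepeat.unique {f : ℤ → B} {i i' p s s' x : ℤ} (h : IsMaxRepeat f i p s)
    (h' : IsMaxRepeat f i' p s') (hx : i ≤ x) (hxs : x < i + s) (hx' : i' ≤ x)
    (hxs' : x < i' + s') : i = i' ∧ s = s' := by
  have hi : i = i' := by
    rcases lt_trichotomy i i' with hlt | heq | hlt
    · exact absurd (h.eq_shift (i' - 1) (by lia) (by lia)) h'.left_ne
    · exact heq
    · exact absurd (h'.eq_shift (i - 1) (by lia) (by lia)) h.left_ne
  subst hi
  refine ⟨rfl, ?_⟩
  rcases lt_trichotomy s s' with hlt | heq | hlt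
  · exact absurd (h'.eq_shift (i + s) (by lia) (by lia)) h.right_ne
  · exact heq
  · exact absurd (h.eq_shift (i + s') (by lia) (by lia)) h'.right_ne

/-- The centre of the square of an unbordered word determines the length of that word. -/
theorem Unbordered.length_unique {f : ℤ → B} {h q q' : ℤ} (hq : 0 < q) (hq' : 0 < q')
    (hper : PeriodOn f q (h - q) (h + q)) (hper' : PeriodOn f q' (h - q') (h + q'))
    (hun : Unbordered f h q) (hun' : Unbordered f h q') : q = q' := by
  have key : ∀ {a b : ℤ}, 0 < a → a < b → PeriodOn f a (h - a) (h + a) →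
      PeriodOn f b (h - b) (h + b) → ¬ Unbordered f h b := by
    intro a b ha hab hpa hpb hu
    -- From `x - a` the two periods lead to `x` and to `x + (b - a)`.
    refine hu (b - a) (by lia) (by lia) fun x hx hx' => ?_
    have h1 := hpa (x - a) (by lia) (by lia)
    have h2 := hpb (x - a) (by lia) (by lia)
    rw [show x - a + a = x by ring] at h1
    rw [show x - a + b = x + (b - a) by ring] at h2
    exact h1.symm.trans h2
  rcases lt_trichotomy q q' with hlt | heq | hlt
  · exact absurd hun' (key hq hlt hper hper')
  · exact heq
  · exact absurd hun (key hq' hlt hper' hper)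

/-- A periodic two-sided infinite word with least period `q` has an unbordered factor of
length `q`: its lexicographically least rotation. -/
theorem exists_unbordered_of_periodic {g : ℤ → B} {q : ℤ} (hq : 0 < q)
    (hg : ∀ x, g (x + q) = g x) (hmin : ∀ d, 0 < d → d < q → ¬ ∀ x, g (x + d) = g x) :
    ∃ j, Unbordered g j q := by
  classical
  let : LinearOrder B := linearOrderOfSTO WellOrderingRel
  let rot : ℤ → Lex (ℕ → B) := fun j => toLex fun t => g (j + t)
  have hrot : ∀ j t, rot j t = g (j + t) := fun _ _ => rfl
  have hrotq : ∀ j, rot (j + q) = rot j := by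
    intro j
    funext t
    rw [hrot, hrot, ← hg (j + t)]
    congr 1; ring
  have hper : Function.Periodic rot q := hrotq
  obtain ⟨j, -, hj⟩ := Finset.exists_min_image (Finset.Ico 0 q) rot ⟨0, by simp [hq]⟩
  have hjmin : ∀ k, rot j ≤ rot k := by
    intro k
    have h1 := hj (k % q) (by simp [Int.emod_nonneg _ hq.ne', Int.emod_lt_of_pos _ hq])
    have h2 : rot (k % q) = rot k := by
      have := hper.sub_zsmul_eq (k / q) (x := k)
      rwa [smul_eq_mul, show k - k / q * q = k % q by
        have := Int.emod_add_mul_ediv k q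
        linarith] at this
    rwa [h2] at h1
  refine ⟨j, fun d hd hdq hpd => ?_⟩
  -- Period `d` makes `rot (j + d)` and `rot j` agree on `q - d` letters; beyond these they continue
  -- as `rot (j + q) = rot j` and `rot (j + (q - d))`. Minimality of `rot j` compares the tails.
  have hle : rot (j + (q - d)) ≤ rot j := by
    by_contra hlt
    rw [not_le, ← hrotq j] at hlt
    obtain ⟨t, ht, htlt⟩ := hlt
    refine absurd (hjmin (j + d)) (not_le.2 ⟨(q - d).toNat + t, fun u hu => ?_, ?_⟩)
    · change g (j + d + u) = g (j + u)
      by_cases hu' : (u : ℤ) < q - d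
      · have := hpd (j + u) (by lia) (by lia)
        rw [this]; congr 1; ring
      · have := ht (u - (q - d).toNat) (by change u < (q - d).toNat + t at hu; change _ < t; lia)
        change g (j + q + _) = g (j + (q - d) + _) at this
        convert this using 2 <;> lia
    · change g (j + q + _) < g (j + (q - d) + _) at htlt
      change g (j + d + _) < g (j + _)
      convert htlt using 2 <;> lia
  have heq : rot (j + (q - d)) = rot j := le_antisymm hle (hjmin _)
  refine hmin (q - d) (by lia) (by lia) fun x => ?_
  have h1 : ∀ t : ℕ, g (j + (q - d) + t) = g (j + t) := fun t => congrFun heq t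
  have hgp : Function.Periodic g q := hg
  have h2 := h1 (((x - j) % q).toNat)
  have h3 : ∀ y, g (y + (x - j) / q * q) = g y := fun y => by
    have := hgp.zsmul ((x - j) / q) y
    rwa [zsmul_eq_mul] at this
  have h4 := Int.emod_add_mul_ediv (x - j) q
  have h5 := Int.emod_nonneg (x - j) hq.ne'
  rw [← h3 (j + (q - d) + _), ← h3 (j + _)] at h2
  convert h2 using 2 <;> rw [Int.toNat_of_nonneg h5] <;> linarith

/-- A word with least period `q` and length at least `3 * q` has an unbordered factor of length
`q` starting in its second period. -/
theorem PeriodOn.exists_unbordered {f : ℤ → B} {q a e : ℤ} (hq : 0 < q)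
    (hper : PeriodOn f q a e) (hae : a + 3 * q ≤ e)
    (hmin : ∀ d, 0 < d → d < q → ¬ PeriodOn f d a e) :
    ∃ h, a + q ≤ h ∧ h < a + 2 * q ∧ Unbordered f h q := by
  -- The two-sided periodic extension of the first `q` letters; it agrees with `f` on `[a, e)`.
  let g : ℤ → B := fun x => f (a + (x - a) % q)
  have hg : ∀ x, g (x + q) = g x := fun x => by
    change f _ = f _
    rw [show x + q - a = x - a + q by ring, Int.add_emod_right]
  have hgp : Function.Periodic g q := hg
  have hgf : ∀ n : ℕ, ∀ x, a ≤ x → x < e → (x - a).toNat = n → g x = f x := by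
    intro n
    induction n using Nat.strong_induction_on with
    | _ n ih =>
      intro x hx hxe hn
      by_cases hlt : x - a < q
      · change f _ = f _
        rw [Int.emod_eq_of_lt (by lia) hlt]
        congr 1; ring
      · have h1 := ih (x - q - a).toNat (by lia) (x - q) (by lia) (by lia) rfl
        have h2 := hper (x - q) (by lia) (by lia)
        rw [← hg (x - q)] at h1
        rw [sub_add_cancel] at h1 h2
        exact h1.trans h2
  obtain ⟨j, hj⟩ := exists_unbordered_of_periodic hq hg fun d hd hdq hgd => by
    refine hmin d hd hdq fun x hx hx' => ?_
    rw [← hgf _ x hx (by lia) rfl, ← hgf _ (x + d) (by lia) hx' rfl, hgd]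
  have h1 := Int.emod_nonneg (j - a) hq.ne'
  have h2 := Int.emod_lt_of_pos (j - a) hq
  refine ⟨a + q + (j - a) % q, by lia, by lia, fun d hd hdq hpd => hj d hd hdq ?_⟩
  intro x hx hx'
  have h3 : ∀ y, g (y + (1 - (j - a) / q) * q) = g y := fun y => by
    have := hgp.zsmul (1 - (j - a) / q) y
    rwa [zsmul_eq_mul] at this
  have h4 := Int.emod_add_mul_ediv (j - a) q
  have h5 : a + q + (j - a) % q = j + (1 - (j - a) / q) * q := by linarith
  rw [← h3 x, ← h3 (x + d), hgf _ _ (by lia) (by lia) rfl, hgf _ _ (by lia) (by lia) rfl,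
    hpd _ (by lia) (by lia)]
  congr 1; ring

/-- Two shifts of a word of length `3 * q` that differ by less than `q` coincide, if the word
contains an unbordered factor of length `q`. -/
theorem Unbordered.shift_unique {f : ℤ → B} {a q h P P' : ℤ} (hun : Unbordered f h q)
    (hah : a ≤ h) (hh : h + q ≤ a + 3 * q)
    (hP : ∀ x, a ≤ x → x < a + 3 * q → f x = f (x + P))
    (hP' : ∀ x, a ≤ x → x < a + 3 * q → f x = f (x + P')) (hlt : |P - P'| < q) : P = P' := by
  have key : ∀ {P P' : ℤ}, (∀ x, a ≤ x → x < a + 3 * q → f x = f (x + P)) →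
      (∀ x, a ≤ x → x < a + 3 * q → f x = f (x + P')) → P < P' → ¬ P' - P < q := by
    intro P P' hP hP' hPP hq
    refine hun (P' - P) (by lia) hq fun x hx hx' => ?_
    rw [hP' x (by lia) (by lia), hP (x + (P' - P)) (by lia) (by lia)]
    congr 1; ring
  rw [abs_lt] at hlt
  rcases lt_trichotomy P P' with h1 | h1 | h1
  · exact absurd (by lia) (key hP hP' h1)
  · exact h1
  · exact absurd (by lia) (key hP' hP h1)

/-- Extend a periodic interval to the left, at most down to `i`. -/
theorem PeriodOn.extend_left {f : ℤ → B} {q u v i : ℤ} (hper : PeriodOn f q u v) (hiu : i ≤ u) :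
    (∃ a, i ≤ a ∧ a ≤ u ∧ PeriodOn f q a v ∧ f (a - 1) ≠ f (a - 1 + q)) ∨
      f (i - 1) = f (i - 1 + q) := by
  by_cases hex : ∃ x, i - 1 ≤ x ∧ x < u ∧ f x ≠ f (x + q)
  · obtain ⟨x, ⟨hx1, hx2, hx3⟩, hmax⟩ := Int.exists_greatest_of_bdd
      (P := fun x => i - 1 ≤ x ∧ x < u ∧ f x ≠ f (x + q)) ⟨u, fun z hz => hz.2.1.le⟩ hex
    refine Or.inl ⟨x + 1, by lia, by lia, fun y hy hy' => ?_, by simpa using hx3⟩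
    by_cases hyu : u ≤ y
    · exact hper y hyu hy'
    · by_contra hne
      have := hmax y ⟨by lia, by lia, hne⟩
      lia
  · push Not at hex
    by_cases hiu' : i - 1 < u
    · exact Or.inr (hex (i - 1) le_rfl hiu')
    · lia

/-! ### Repeats whose arms have a short period -/

/-- The interval `[a, j + 9 * g)` has the short period `q`, breaks this period at its left end
`a ∈ [j, j + g]`, and has an unbordered factor of length `q` starting at `h` in its second
period. -/
structure IsAnchored (f : ℤ → B) (j g a q h : ℤ) : Prop where
  pos : 0 < q
  le_gap : q ≤ g
  le_anchor : j ≤ a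
  anchor_le : a ≤ j + g
  periodOn : PeriodOn f q a (j + 9 * g)
  break_left : f (a - 1) ≠ f (a - 1 + q)
  le_centre : a + q ≤ h
  centre_lt : h < a + 2 * q
  unbordered : Unbordered f h q

/-- If the period `q` reached one letter beyond the left end of both arms, these two letters would
be copies of equal letters inside the arms, against left maximality. -/
theorem IsMaxRepeat.exists_isAnchored {f : ℤ → B} {i p s g d : ℤ} (hr : IsMaxRepeat f i p s)
    (hgs : 10 * g ≤ s) (hd : 0 < d) (hdg : d ≤ g) (hper : PeriodOn f d (i + g) (i + 9 * g)) :
    (∃ a q h, IsAnchored f i g a q h) ∨ ∃ a q h, IsAnchored f (i + p) g a q h := by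
  obtain ⟨q, ⟨hq, hqper⟩, hqmin⟩ := Int.exists_least_of_bdd
    (P := fun q => 0 < q ∧ PeriodOn f q (i + g) (i + 9 * g)) ⟨0, fun z hz => hz.1.le⟩ ⟨d, hd, hper⟩
  have hqg : q ≤ g := (hqmin d ⟨hd, hper⟩).trans hdg
  have hmin : ∀ e, 0 < e → e < q → ¬ PeriodOn f e (i + g) (i + 9 * g) := fun e he heq hpe => by
    have := hqmin e ⟨he, hpe⟩
    lia
  have hqper' : PeriodOn f q (i + p + g) (i + p + 9 * g) := fun x hx hx' => by
    have h1 := hr.eq_shift (x - p) (by lia) (by lia)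
    have h2 := hr.eq_shift (x - p + q) (by lia) (by lia)
    have h3 := hqper (x - p) (by lia) (by lia)
    rw [sub_add_cancel] at h1
    rw [show x - p + q + p = x + q by ring] at h2
    rw [← h1, h3, h2]
  have hmin' : ∀ e, 0 < e → e < q → ¬ PeriodOn f e (i + p + g) (i + p + 9 * g) := by
    intro e he heq hpe
    refine hmin e he heq fun x hx hx' => ?_
    have h1 := hr.eq_shift x (by lia) (by lia)
    have h2 := hr.eq_shift (x + e) (by lia) (by lia)
    have h3 := hpe (x + p) (by lia) (by lia)
    rw [show x + p + e = x + e + p by ring] at h3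
    rw [h1, h3, ← h2]
  have anchor : ∀ {j}, PeriodOn f q (j + g) (j + 9 * g) →
      (∀ e, 0 < e → e < q → ¬ PeriodOn f e (j + g) (j + 9 * g)) →
      (∃ a q h, IsAnchored f j g a q h) ∨ f (j - 1) = f (j - 1 + q) := by
    intro j hj hjmin
    rcases hj.extend_left (i := j) (by lia) with ⟨a, ha1, ha2, ha3, ha4⟩ | h
    · obtain ⟨h, hh1, hh2, hh3⟩ := ha3.exists_unbordered hq (by lia) fun e he heq hpe =>
        hjmin e he heq (hpe.mono ha2 le_rfl)
      exact Or.inl ⟨a, q, h, hq, hqg, ha1, ha2, ha3, ha4, hh1, hh2, hh3⟩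
    · exact Or.inr h
  rcases anchor hqper hmin with h | hl
  · exact Or.inl h
  rcases anchor hqper' hmin' with h | hl'
  · exact Or.inr h
  refine absurd ?_ hr.left_ne
  have h1 := hr.eq_shift (i - 1 + q) (by lia) (by lia)
  rw [hl, h1, show i - 1 + p = i + p - 1 by ring, hl']
  congr 1; ring

/-- Keeps the displaced centre inside the periodic interval: `9 = 1 + 2 + 5 + 1` counts units of `g`
for the anchor, the offset of `h`, the displacement and a last period. -/
theorem IsAnchored.mul_ediv_le {f : ℤ → B} {j g a q h p M : ℤ} (hA : IsAnchored f j g a q h)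
    (hM : 0 < M) (hp : p ≤ 5 * g * M) : q * (p / q / M) ≤ 5 * g := by
  have hq := hA.pos
  have h1 : p / q / M * M ≤ p / q := Int.ediv_mul_le _ hM.ne'
  have h2 : p / q * q ≤ p := Int.ediv_mul_le _ hq.ne'
  refine le_of_mul_le_mul_right ?_ hM
  nlinarith

/-- An anchored interval, and the period `p` up to an error less than `q`, can be recovered from
a position of the interval and a residue modulo `M`. -/
theorem IsAnchored.unique {f : ℤ → B} {j j' g g' a a' q q' h h' p p' M : ℤ}
    (hA : IsAnchored f j g a q h) (hA' : IsAnchored f j' g' a' q' h') (hM : 0 < M)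
    (hp : 0 ≤ p) (hp' : 0 ≤ p') (hpM : p ≤ 5 * g * M) (hpM' : p' ≤ 5 * g' * M)
    (hcentre : h + q * (p / q / M) = h' + q' * (p' / q' / M))
    (hmod : p / q % M = p' / q' % M) : a = a' ∧ q = q' ∧ h = h' ∧ |p - p'| < q := by
  have shift : ∀ {j g a q h k : ℤ}, IsAnchored f j g a q h → 0 ≤ k → q * k ≤ 5 * g →
      PeriodOn f q (h + q * k - q) (h + q * k + q) ∧ Unbordered f (h + q * k) q ∧
        a + q ≤ h + q * k ∧ h + q * k + q ≤ j + 9 * g := by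
    intro j g a q h k hA hk hkg
    have := hA.pos
    have := hA.le_gap
    have := hA.le_anchor
    have := hA.anchor_le
    have := hA.le_centre
    have := hA.centre_lt
    have hqk : 0 ≤ q * k := by positivity
    refine ⟨hA.periodOn.mono (by lia) (by lia), ?_, by lia, by lia⟩
    have hshift : ∀ k : ℕ, ∀ x, a ≤ x → x + q * k < j + 9 * g → f x = f (x + q * k) := by
      intro k
      induction k with
      | zero => intro x _ _; simp
      | succ k ih =>
        intro x hx hx'
        push_cast at hx' ⊢
        rw [mul_add, mul_one, ← add_assoc] at hx' ⊢
        rw [ih x hx (by lia)]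
        exact hA.periodOn _ (by nlinarith) hx'
    intro d hd hdq hpd
    refine hA.unbordered d hd hdq fun x hx hx' => ?_
    lift k to ℕ using hk
    rw [hshift k x (by lia) (by lia), hshift k (x + d) (by lia) (by lia),
      hpd (x + q * k) (by lia) (by lia)]
    congr 1; ring
  have hq := hA.pos
  have hq' := hA'.pos
  have hk : 0 ≤ p / q / M := Int.ediv_nonneg (Int.ediv_nonneg hp hq.le) hM.le
  have hk' : 0 ≤ p' / q' / M := Int.ediv_nonneg (Int.ediv_nonneg hp' hq'.le) hM.le
  obtain ⟨h1, h2, h3, h4⟩ := shift hA hk (hA.mul_ediv_le hM hpM)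
  obtain ⟨h1', h2', h3', h4'⟩ := shift hA' hk' (hA'.mul_ediv_le hM hpM')
  rw [← hcentre] at h1' h2' h3' h4'
  have hqq : q = q' := Unbordered.length_unique hq hq' h1 h1' h2 h2'
  subst hqq
  have haa : a = a' := by
    rcases lt_trichotomy a a' with hlt | heq | hlt
    · exact absurd (hA.periodOn (a' - 1) (by lia) (by lia)) hA'.break_left
    · exact heq
    · exact absurd (hA'.periodOn (a - 1) (by lia) (by lia)) hA.break_left
  subst haa
  have := hA.le_centre
  have := hA.centre_lt
  have := hA'.le_centre
  have := hA'.centre_lt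
  -- `h` and `h'` lie in the same window of length `q`, so they cannot differ by a nonzero multiple
  -- of `q`.
  have hkk : p / q / M = p' / q / M := by
    rcases lt_trichotomy (p / q / M) (p' / q / M) with hlt | heq | hlt
    · nlinarith
    · exact heq
    · nlinarith
  rw [hkk] at hcentre
  have hpp : p / q = p' / q := by
    rw [← Int.emod_add_mul_ediv (p / q) M, ← Int.emod_add_mul_ediv (p' / q) M, hmod, hkk]
  refine ⟨rfl, rfl, by lia, ?_⟩
  have e1 := Int.emod_add_mul_ediv p q
  have e2 := Int.emod_add_mul_ediv p' q
  have l1 := Int.emod_nonneg p hq.ne'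
  have l2 := Int.emod_nonneg p' hq.ne'
  have u1 := Int.emod_lt_of_pos p hq
  have u2 := Int.emod_lt_of_pos p' hq
  rw [hpp] at e1
  rw [abs_lt]
  constructor <;> linarith

/-- The number of maximal repeats one of whose arms (the left one for `c = 0`, the right one for
`c = 1`) is anchored. -/
theorem card_anchored_le {f : ℤ → B} {c : ℤ} (hc : c = 0 ∨ c = 1) {n M : ℕ} (hM : 0 < M)
    {G : ℤ → ℤ} (S : Finset (ℤ × ℤ × ℤ))
    (hS : ∀ r ∈ S, IsMaxRepeat f r.1 r.2.1 r.2.2 ∧ 0 ≤ r.1 ∧ r.1 + r.2.1 + r.2.2 ≤ n ∧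
      10 * G r.2.1 ≤ r.2.2 ∧ r.2.1 ≤ 5 * G r.2.1 * M ∧
      ∃ a q h, IsAnchored f (r.1 + c * r.2.1) (G r.2.1) a q h) :
    S.card ≤ n * M := by
  classical
  have hcard : (Finset.Ico (0 : ℤ) n ×ˢ Finset.Ico (0 : ℤ) M).card = n * M := by
    simp
  rw [← hcard]
  refine Finset.card_le_card_of_forall_subsingleton
    (fun r t => ∃ a q h, IsAnchored f (r.1 + c * r.2.1) (G r.2.1) a q h ∧
      t.1 = h + q * (r.2.1 / q / M) ∧ t.2 = r.2.1 / q % M) ?_ ?_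
  · intro r hr
    obtain ⟨hrep, hi, hn, hG, hpM, a, q, h, hA⟩ := hS r hr
    refine ⟨(h + q * (r.2.1 / q / M), r.2.1 / q % M), ?_, a, q, h, hA, rfl, rfl⟩
    have h1 := hA.mul_ediv_le (by exact_mod_cast hM) hpM
    have := hA.pos
    have := hA.le_gap
    have := hA.le_anchor
    have := hA.anchor_le
    have := hA.le_centre
    have := hA.centre_lt
    have hp := hrep.period_pos
    have h2 : 0 ≤ q * (r.2.1 / q / M) :=
      mul_nonneg hA.pos.le (Int.ediv_nonneg (Int.ediv_nonneg hp.le hA.pos.le) (by positivity))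
    have h3 : 0 ≤ c * r.2.1 := by rcases hc with rfl | rfl <;> lia
    have h4 : c * r.2.1 ≤ r.2.1 := by rcases hc with rfl | rfl <;> lia
    simp only [Finset.mem_product, Finset.mem_Ico]
    refine ⟨⟨by lia, by lia⟩, Int.emod_nonneg _ (by lia), Int.emod_lt_of_pos _ (by lia)⟩
  · rintro t - r ⟨hr, a, q, h, hA, ht1, ht2⟩ r' ⟨hr', a', q', h', hA', ht1', ht2'⟩
    obtain ⟨hrep, -, -, hG, hpM, -⟩ := hS r hr
    obtain ⟨hrep', -, -, hG', hpM', -⟩ := hS r' hr'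
    obtain ⟨i, p, s⟩ := r
    obtain ⟨i', p', s'⟩ := r'
    dsimp only at *
    obtain ⟨rfl, rfl, rfl, hpp⟩ := hA.unique hA' (by exact_mod_cast hM) hrep.period_pos.le
      hrep'.period_pos.le hpM hpM' (ht1.symm.trans ht1') (ht2.symm.trans ht2')
    have := hA.pos
    have := hA.le_gap
    have := hA.le_anchor
    have := hA.anchor_le
    have := hA.le_centre
    have := hA.centre_lt
    have := hA'.le_gap
    have := hA'.le_anchor
    have := hA'.anchor_le
    have arm : ∀ {i p s}, IsMaxRepeat f i p s →
        ∀ x, i + c * p ≤ x → x < i + c * p + s → f x = f (x + (1 - 2 * c) * p) := by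
      intro i p s hrep x hx hx'
      rcases hc with rfl | rfl
      · simpa using hrep.eq_shift x (by lia) (by lia)
      · have := hrep.eq_shift (x - p) (by lia) (by lia)
        rw [sub_add_cancel] at this
        rw [← this]
        congr 1; ring
    -- The shift by `(1 - 2c)p` carries the anchored arm to the other arm: `p` for `c = 0`, `-p` for
    -- `c = 1`.
    have hshift := hA.unbordered.shift_unique (a := a) (P := (1 - 2 * c) * p)
      (P' := (1 - 2 * c) * p') (by lia) (by lia) (fun x hx hx' => arm hrep x (by lia) (by lia))
      (fun x hx hx' => arm hrep' x (by lia) (by lia)) (by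
        rw [← mul_sub, abs_mul]
        rcases hc with rfl | rfl <;> simpa using hpp)
    have hpeq : p = p' := by rcases hc with rfl | rfl <;> lia
    subst hpeq
    obtain ⟨rfl, rfl⟩ := hrep.unique hrep' (x := a - c * p) (by lia) (by lia) (by lia) (by lia)
    rfl

/-! ### Charging repeats without a short period, and the total count -/

theorem sum_int_inv_sq_le (N : ℕ) : ∑ y ∈ Finset.Ioo (0 : ℤ) N, ((y : ℝ) ^ 2)⁻¹ ≤ 2 := by
  have h : ∑ y ∈ Finset.Ioo (0 : ℤ) N, ((y : ℝ) ^ 2)⁻¹ =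
      ∑ y ∈ Finset.Ioo 0 N, ((y : ℝ) ^ 2)⁻¹ := by
    refine Finset.sum_nbij' Int.toNat Nat.cast ?_ ?_ ?_ ?_ ?_
    · intro y hy
      simp only [Finset.mem_Ioo] at hy ⊢
      lia
    · intro y hy
      simp only [Finset.mem_Ioo] at hy ⊢
      lia
    · intro y hy
      simp only [Finset.mem_Ioo] at hy
      lia
    · intro y hy
      simp
    · intro y hy
      simp only [Finset.mem_Ioo] at hy
      have : ((y.toNat : ℤ) : ℝ) = y := by rw [Int.toNat_of_nonneg hy.1.le]
      rw [← this, Int.cast_natCast]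
  rw [h]
  simpa using sum_Ioo_inv_sq_le (α := ℝ) 0 N

/-- The unit in which the arms of a repeat with the period `p` are measured. -/
noncomputable def gap (δ : ℝ) (p : ℤ) : ℤ := ⌊δ * p / 10⌋

theorem gap_mono {δ : ℝ} (hδ : 0 < δ) {p p' : ℤ} (h : p ≤ p') : gap δ p ≤ gap δ p' := by
  unfold gap
  gcongr

theorem gap_nonneg {δ : ℝ} (hδ : 0 < δ) {p : ℤ} (h : 0 < p) : 0 ≤ gap δ p :=
  Int.floor_nonneg.2 (by positivity)

theorem ten_mul_gap_le {δ : ℝ} {p s : ℤ} (h : δ * p ≤ s) : 10 * gap δ p ≤ s := by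
  have h1 : (gap δ p : ℝ) ≤ δ * p / 10 := Int.floor_le _
  have h2 : ((10 * gap δ p : ℤ) : ℝ) ≤ s := by push_cast; linarith
  exact_mod_cast h2

theorem lt_gap_add_one (δ : ℝ) (p : ℤ) : δ * p < 10 * (gap δ p + 1) := by
  have h1 : δ * p / 10 < gap δ p + 1 := Int.lt_floor_add_one _
  linarith

/-- The points charged to a repeat with left end `i` and period `p`. -/
noncomputable def box (δ : ℝ) (i p : ℤ) : Finset (ℤ × ℤ) :=
  Finset.Icc i (i + gap δ p) ×ˢ Finset.Icc p (p + gap δ p)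

/-- The box has `(g + 1)² ≥ (δp/10)²` points, each of weight at least `1/(2p)²`. -/
theorem le_sum_box {δ : ℝ} (hδ : 0 < δ) (hδ1 : δ < 1) {p : ℤ} (i : ℤ) (hp : 0 < p) :
    δ ^ 2 / 400 ≤ ∑ t ∈ box δ i p, ((t.2 : ℝ) ^ 2)⁻¹ := by
  have hg := gap_nonneg hδ hp
  have hg1 := lt_gap_add_one δ p
  have hp' : (0 : ℝ) < p := by exact_mod_cast hp
  have hg' : (0 : ℝ) ≤ gap δ p := by exact_mod_cast hg
  have hgp : (gap δ p : ℝ) ≤ p := by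
    have h1 : (gap δ p : ℝ) ≤ δ * p / 10 := Int.floor_le _
    nlinarith
  have hcard : ((box δ i p).card : ℝ) = ((gap δ p : ℝ) + 1) ^ 2 := by
    have h1 : ∀ u : ℤ, ((Finset.Icc u (u + gap δ p)).card : ℝ) = gap δ p + 1 := by
      intro u
      rw [Int.card_Icc, show u + gap δ p + 1 - u = gap δ p + 1 by ring]
      have : (((gap δ p + 1).toNat : ℤ) : ℝ) = gap δ p + 1 := by
        rw [Int.toNat_of_nonneg (by lia)]
        push_cast; ring
      rwa [Int.cast_natCast] at this
    rw [box, Finset.card_product, Nat.cast_mul, h1, h1, sq]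
  have hterm : ∀ t ∈ box δ i p, ((2 * (p : ℝ)) ^ 2)⁻¹ ≤ ((t.2 : ℝ) ^ 2)⁻¹ := by
    intro t ht
    simp only [box, Finset.mem_product, Finset.mem_Icc] at ht
    have h1 : (p : ℝ) ≤ t.2 := by exact_mod_cast ht.2.1
    have h2 : (t.2 : ℝ) ≤ p + gap δ p := by exact_mod_cast ht.2.2
    have h3 : (0 : ℝ) < t.2 := hp'.trans_le h1
    gcongr
    linarith
  refine le_trans ?_ (Finset.card_nsmul_le_sum _ _ _ hterm)
  rw [nsmul_eq_mul, hcard, ← div_eq_mul_inv, div_le_div_iff₀ (by norm_num) (by positivity)]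
  have : (δ * p) ^ 2 ≤ (10 * ((gap δ p : ℝ) + 1)) ^ 2 := by gcongr
  nlinarith

/-- Two distinct maximal repeats charging the same point force a short period in the left arm of
the one with the smaller period. -/
theorem exists_short_period {f : ℤ → B} {δ : ℝ} (hδ : 0 < δ) {i p s i' p' s' : ℤ}
    (h : IsMaxRepeat f i p s) (h' : IsMaxRepeat f i' p' s') (hs : δ * p ≤ s) (hs' : δ * p' ≤ s')
    (hpp : p ≤ p') (hne : (i, p, s) ≠ (i', p', s')) {t : ℤ × ℤ} (ht : t ∈ box δ i p)
    (ht' : t ∈ box δ i' p') :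
    ∃ d, 0 < d ∧ d ≤ gap δ p ∧ PeriodOn f d (i + gap δ p) (i + 9 * gap δ p) := by
  simp only [box, Finset.mem_product, Finset.mem_Icc] at ht ht'
  have hg := gap_nonneg hδ h.period_pos
  have hgg := gap_mono hδ hpp
  have h10 := ten_mul_gap_le hs
  have h10' := ten_mul_gap_le hs'
  have hspos := h.arm_pos
  have hspos' := h'.arm_pos
  rcases hpp.eq_or_lt with rfl | hlt
  · obtain ⟨rfl, rfl⟩ := h.unique h' (x := t.1) (by lia) (by lia) (by lia) (by lia)
    exact absurd rfl hne
  -- The middle of the first left arm lies in both left arms, and `x + p' = (x + (p' - p)) + p`.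
  · refine ⟨p' - p, by lia, by lia, fun x hx hx' => ?_⟩
    rw [h'.eq_shift x (by lia) (by lia), h.eq_shift (x + (p' - p)) (by lia) (by lia)]
    congr 1; ring

/-- The number of maximal repeats whose left arm has no short period. -/
theorem card_nonperiodic_le {f : ℤ → B} {δ : ℝ} (hδ : 0 < δ) (hδ1 : δ < 1) {n : ℕ}
    (S : Finset (ℤ × ℤ × ℤ))
    (hS : ∀ r ∈ S, IsMaxRepeat f r.1 r.2.1 r.2.2 ∧ 0 ≤ r.1 ∧ r.1 + r.2.1 + r.2.2 ≤ n ∧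
      δ * r.2.1 ≤ r.2.2 ∧ ¬ ∃ d, 0 < d ∧ d ≤ gap δ r.2.1 ∧
        PeriodOn f d (r.1 + gap δ r.2.1) (r.1 + 9 * gap δ r.2.1)) :
    (S.card : ℝ) ≤ 800 * (n / δ ^ 2) := by
  classical
  have hdisj : (S : Set (ℤ × ℤ × ℤ)).PairwiseDisjoint fun r => box δ r.1 r.2.1 := by
    intro r hr r' hr' hne
    obtain ⟨h, -, -, hs, hnp⟩ := hS r hr
    obtain ⟨h', -, -, hs', hnp'⟩ := hS r' hr'
    refine Finset.disjoint_left.2 fun t ht ht' => ?_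
    rcases le_total r.2.1 r'.2.1 with hle | hle
    · exact hnp (exists_short_period hδ h h' hs hs' hle hne ht ht')
    · exact hnp' (exists_short_period hδ h' h hs' hs hle hne.symm ht' ht)
  have hsub : S.biUnion (fun r => box δ r.1 r.2.1) ⊆
      Finset.Ico (0 : ℤ) n ×ˢ Finset.Ioo (0 : ℤ) (n + 1 : ℕ) := by
    intro t ht
    obtain ⟨r, hr, ht⟩ := Finset.mem_biUnion.1 ht
    obtain ⟨h, h0, hn, hs, -⟩ := hS r hr
    have hg := gap_nonneg hδ h.period_pos
    have h10 := ten_mul_gap_le hs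
    have := h.period_pos
    have := h.arm_pos
    simp only [box, Finset.mem_product, Finset.mem_Icc, Finset.mem_Ico, Finset.mem_Ioo] at ht ⊢
    push_cast
    lia
  have hsum : (S.card : ℝ) * (δ ^ 2 / 400) ≤ n * 2 :=
    calc (S.card : ℝ) * (δ ^ 2 / 400) = S.card • (δ ^ 2 / 400) := by rw [nsmul_eq_mul]
      _ ≤ ∑ r ∈ S, ∑ t ∈ box δ r.1 r.2.1, ((t.2 : ℝ) ^ 2)⁻¹ :=
        Finset.card_nsmul_le_sum _ _ _ fun r hr => le_sum_box hδ hδ1 _ (hS r hr).1.period_pos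
      _ = ∑ t ∈ S.biUnion (fun r => box δ r.1 r.2.1), ((t.2 : ℝ) ^ 2)⁻¹ :=
        (Finset.sum_biUnion hdisj).symm
      _ ≤ ∑ t ∈ Finset.Ico (0 : ℤ) n ×ˢ Finset.Ioo (0 : ℤ) (n + 1 : ℕ), ((t.2 : ℝ) ^ 2)⁻¹ :=
        Finset.sum_le_sum_of_subset_of_nonneg hsub fun t _ _ => by positivity
      _ = n * ∑ y ∈ Finset.Ioo (0 : ℤ) (n + 1 : ℕ), ((y : ℝ) ^ 2)⁻¹ := by
        rw [Finset.sum_product]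
        dsimp only
        rw [Finset.sum_const, nsmul_eq_mul, Int.card_Ico]
        simp
      _ ≤ n * 2 := by
        gcongr
        exact sum_int_inv_sq_le _
  rw [mul_div_assoc', le_div_iff₀ (by positivity)]
  linarith

theorem card_maxRepeats_le {f : ℤ → B} {δ : ℝ} (hδ : 0 < δ) (hδ1 : δ < 1) {n : ℕ}
    (S : Finset (ℤ × ℤ × ℤ))
    (hS : ∀ r ∈ S, IsMaxRepeat f r.1 r.2.1 r.2.2 ∧ 0 ≤ r.1 ∧ r.1 + r.2.1 + r.2.2 ≤ n ∧
      δ * r.2.1 ≤ r.2.2) :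
    (S.card : ℝ) ≤ 810 * (n / δ ^ 2) := by
  classical
  let Short : ℤ × ℤ × ℤ → Prop := fun r => ∃ d, 0 < d ∧ d ≤ gap δ r.2.1 ∧
    PeriodOn f d (r.1 + gap δ r.2.1) (r.1 + 9 * gap δ r.2.1)
  let Anch : ℤ → ℤ × ℤ × ℤ → Prop := fun c r =>
    ∃ a q h, IsAnchored f (r.1 + c * r.2.1) (gap δ r.2.1) a q h
  have hcover : S ⊆ S.filter (fun r => ¬ Short r) ∪ (S.filter (Anch 0) ∪ S.filter (Anch 1)) := by
    intro r hr
    by_cases hsh : Short r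
    · obtain ⟨h, -, -, hs⟩ := hS r hr
      obtain ⟨d, hd, hdg, hper⟩ := hsh
      rcases h.exists_isAnchored (ten_mul_gap_le hs) hd hdg hper with hA | hA
      · refine Finset.mem_union_right _ (Finset.mem_union_left _ (Finset.mem_filter.2 ⟨hr, ?_⟩))
        simpa [Anch] using hA
      · refine Finset.mem_union_right _ (Finset.mem_union_right _ (Finset.mem_filter.2 ⟨hr, ?_⟩))
        simpa [Anch] using hA
    · exact Finset.mem_union_left _ (Finset.mem_filter.2 ⟨hr, hsh⟩)
  have hnon : ((S.filter (fun r => ¬ Short r)).card : ℝ) ≤ 800 * (n / δ ^ 2) := by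
    refine card_nonperiodic_le (f := f) hδ hδ1 _ fun r hr => ?_
    obtain ⟨hr, hns⟩ := Finset.mem_filter.1 hr
    obtain ⟨h1, h2, h3, h4⟩ := hS r hr
    exact ⟨h1, h2, h3, h4, hns⟩
  -- An anchored repeat has `g ≥ 1`, so `δp < 10(g + 1) ≤ 20g` and `p ≤ 5g · (4/δ)`.
  have hM4 : 4 / δ ≤ (⌈4 / δ⌉₊ : ℝ) := Nat.le_ceil _
  have hMpos : 0 < ⌈4 / δ⌉₊ := Nat.ceil_pos.2 (by positivity)
  have hanch : ∀ c : ℤ, c = 0 ∨ c = 1 → ((S.filter (Anch c)).card : ℝ) ≤ 5 * (n / δ ^ 2) := by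
    intro c hc
    have h1 : (S.filter (Anch c)).card ≤ n * ⌈4 / δ⌉₊ := by
      refine card_anchored_le (f := f) (G := gap δ) hc hMpos _ fun r hr => ?_
      obtain ⟨hr, hA⟩ := Finset.mem_filter.1 hr
      obtain ⟨h1, h2, h3, h4⟩ := hS r hr
      refine ⟨h1, h2, h3, ten_mul_gap_le h4, ?_, hA⟩
      obtain ⟨a, q, h, hA⟩ := hA
      have hg1 : 1 ≤ gap δ r.2.1 := by
        have := hA.pos
        have := hA.le_gap
        lia
      have hg1' : (1 : ℝ) ≤ gap δ r.2.1 := by exact_mod_cast hg1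
      have hlt := lt_gap_add_one δ r.2.1
      have hreal : (r.2.1 : ℝ) ≤ 5 * gap δ r.2.1 * (⌈4 / δ⌉₊ : ℝ) := by
        calc (r.2.1 : ℝ) ≤ 5 * gap δ r.2.1 * (4 / δ) := by
              rw [mul_div_assoc', le_div_iff₀ hδ]
              linarith
          _ ≤ _ := by gcongr
      exact_mod_cast hreal
    have h2 : ((S.filter (Anch c)).card : ℝ) ≤ n * (⌈4 / δ⌉₊ : ℝ) := by exact_mod_cast h1
    have h3 : (⌈4 / δ⌉₊ : ℝ) < 4 / δ + 1 := Nat.ceil_lt_add_one (by positivity)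
    have h4 : 4 / δ + 1 ≤ 5 / δ ^ 2 := by
      rw [div_add_one hδ.ne', div_le_div_iff₀ hδ (by positivity)]
      nlinarith
    calc ((S.filter (Anch c)).card : ℝ) ≤ n * (⌈4 / δ⌉₊ : ℝ) := h2
      _ ≤ n * (5 / δ ^ 2) := by gcongr; linarith
      _ = 5 * (n / δ ^ 2) := by ring
  have hle : S.card ≤ (S.filter (fun r => ¬ Short r)).card +
      ((S.filter (Anch 0)).card + (S.filter (Anch 1)).card) :=
    (Finset.card_le_card hcover).trans ((Finset.card_union_le _ _).trans
      (Nat.add_le_add_left (Finset.card_union_le _ _) _))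
  have hle' : (S.card : ℝ) ≤ (S.filter (fun r => ¬ Short r)).card +
      ((S.filter (Anch 0)).card + (S.filter (Anch 1)).card) := by exact_mod_cast hle
  have h0 := hanch 0 (Or.inl rfl)
  have h1 := hanch 1 (Or.inr rfl)
  linarith

/-! ### From subrepetitions of a word to maximal repeats -/

/-- A word as a function on the integers, with the value `none` outside the word. -/
def letter {A : Type*} (w : List A) (x : ℤ) : Option A :=
  if 0 ≤ x then w[x.toNat]? else none

theorem letter_natCast {A : Type*} (w : List A) (k : ℕ) : letter w k = w[k]? := by
  simp [letter]

theorem minPeriod_spec {A : Type*} {v : List A} (hv : 0 < v.length) :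
    0 < minPeriod v ∧ v.HasPeriod (minPeriod v) :=
  Nat.sInf_mem (s := {p : ℕ | 0 < p ∧ v.HasPeriod p})
    ⟨v.length, hv, v.hasPeriod_of_length_le _ le_rfl⟩

theorem length_factor {A : Type*} {w : List A} {i j : ℕ} (hj : j ≤ w.length) :
    (factor w i j).length = j - i := by
  simp only [factor, List.length_take, List.length_drop]
  lia

theorem getElem?_factor {A : Type*} {w : List A} {i j k : ℕ} (hk : k < j - i) :
    (factor w i j)[k]? = w[i + k]? := by
  rw [factor, List.getElem?_take_of_lt hk, List.getElem?_drop]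

/-- The left end, the minimal period and the arm length of a fragment. -/
noncomputable def toRepeat {A : Type*} (w : List A) (r : ℕ × ℕ) : ℤ × ℤ × ℤ :=
  (r.1, minPeriod (factor w r.1 r.2), (r.2 : ℤ) - r.1 - minPeriod (factor w r.1 r.2))

theorem toRepeat_injective {A : Type*} (w : List A) : Function.Injective (toRepeat w) := by
  rintro ⟨i, j⟩ ⟨i', j'⟩ h
  simp only [toRepeat, Prod.mk.injEq] at h
  ext <;> simp only <;> lia

theorem toRepeat_spec {A : Type*} {w : List A} {δ : ℝ} (hδ : 0 < δ) {r : ℕ × ℕ}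
    (hr : r ∈ maxSubrepetitions δ w) :
    IsMaxRepeat (letter w) (toRepeat w r).1 (toRepeat w r).2.1 (toRepeat w r).2.2 ∧
      0 ≤ (toRepeat w r).1 ∧
      (toRepeat w r).1 + (toRepeat w r).2.1 + (toRepeat w r).2.2 ≤ w.length ∧
      δ * (toRepeat w r).2.1 ≤ (toRepeat w r).2.2 := by
  obtain ⟨⟨⟨hij, hjn⟩, hexp, -⟩, hleft, hright⟩ := hr
  obtain ⟨i, j⟩ := r
  dsimp only at *
  have hlen := length_factor (i := i) hjn
  obtain ⟨hp, hper⟩ := minPeriod_spec (v := factor w i j) (by lia)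
  simp only [toRepeat]
  rw [exponent, hlen] at hexp
  generalize minPeriod (factor w i j) = p at *
  have hp' : (0 : ℝ) < p := by exact_mod_cast hp
  rw [le_div_iff₀ hp', Nat.cast_sub hij.le] at hexp
  have hδp : 0 < δ * p := by positivity
  have hlt : i + p < j := by
    have : (i : ℝ) + p < j := by linarith
    exact_mod_cast this
  rw [List.hasPeriod_iff_getElem?, hlen] at hper
  refine ⟨⟨by lia, by lia, ?_, ?_, ?_⟩, by lia, by lia, ?_⟩
  · intro x hx hx'
    lift x to ℕ using by lia
    have h1 := hper (x - i) (by lia)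
    rw [getElem?_factor (by lia), getElem?_factor (by lia)] at h1
    rw [← Nat.cast_add, letter_natCast, letter_natCast]
    convert h1 using 2 <;> lia
  -- At an end of the word `none` is compared with an actual letter, so maximality is automatic
  -- there.
  · rcases Nat.eq_zero_or_pos i with rfl | hi
    · have h1 : letter w ((0 : ℕ) - 1) = none := by simp [letter]
      rw [h1, show ((0 : ℕ) : ℤ) - 1 + p = (p - 1 : ℕ) by lia, letter_natCast,
        List.getElem?_eq_getElem (by lia)]
      simp
    · have h1 := hleft hi
      rw [show (i : ℤ) - 1 = (i - 1 : ℕ) by lia, ← Nat.cast_add, letter_natCast, letter_natCast]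
      exact h1
  · rw [show (i : ℤ) + (j - i - p) = (j - p : ℕ) by lia, ← Nat.cast_add, letter_natCast,
      letter_natCast, Nat.sub_add_cancel (by lia)]
    rcases hjn.eq_or_lt with rfl | hj
    · rw [List.getElem?_eq_none le_rfl, List.getElem?_eq_getElem (by lia)]
      simp
    · exact hright hj
  · push_cast
    linarith

theorem maxSubrepetitions_finite {A : Type*} (δ : ℝ) (w : List A) :
    (maxSubrepetitions δ w).Finite := by
  refine (Set.finite_Iic (w.length, w.length)).subset fun r hr => ?_
  have h : r.1 < r.2 ∧ r.2 ≤ w.length := hr.1.1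
  exact ⟨by dsimp only; lia, h.2⟩

end Subrep

theorem corollary8 :
    ∃ C : ℝ, 0 < C ∧ ∀ (A : Type*) (w : List A) (δ : ℝ), 0 < δ → δ < 1 →
      (Subrep.maxSubrepetitions δ w).Finite ∧
      ((Subrep.maxSubrepetitions δ w).ncard : ℝ) ≤ C * ((w.length : ℝ) / δ ^ 2) := by
  classical
  refine ⟨810, by norm_num, fun A w δ hδ hδ1 => ?_⟩
  have hfin := Subrep.maxSubrepetitions_finite δ w
  refine ⟨hfin, ?_⟩
  rw [Set.ncard_eq_toFinset_card _ hfin,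
    ← Finset.card_image_of_injective _ (Subrep.toRepeat_injective w)]
  refine Subrep.card_maxRepeats_le (f := Subrep.letter w) hδ hδ1 _ fun r hr => ?_
  obtain ⟨t, ht, rfl⟩ := Finset.mem_image.1 hr
  exact Subrep.toRepeat_spec hδ (hfin.mem_toFinset.1 ht)
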